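/- All graphs are finite, simple and undirected. For a graph $G$ and $X\subseteq V(G)$ let $N_G(X)=\bigcup_{x\in X}N_G(x)$ be the set of vertices adjacent to at least one vertex of $X$. The binding number of $G$ is $$\mathrm{bind}(G)=\min\left\{\frac{|N_G(X)|}{|X|} : \emptyset\neq X\subseteq V(G),\ N_G(X)\neq V(G)\right\},$$ and $G$ is called $r$-binding if $\mathrm{bind}(G)\ge r$. Let $\rho(G)$ denote the largest eigenvalue of the adjacency matrix of $G$. For an odd integer $b\ge 1$, an odd $[1,b]$-factor of $G$ is a spanning subgraph $F$ of $G$ with $d_F(v)\in\{1,3,\ldots,b\}$ for every $v\in V(G)$. Write $\cup$ for disjoint union, $bK_1$ for the disjoint union of $b$ copies of $K_1$, and $\vee$ for the join (the disjoint union of two graphs together with all edges between them). **Theorem.** Let $b\ge 1$ be an odd integer, and let $G$ be a connected $\frac1b$-binding graph of even order $n\ge\max\{12,\,2b+8\}$. If $$\rho(G)\ \ge\ \rho\bigl(K_1\vee(K_{n-b-4}\cup K_3\cup bK_1)\bigr),$$ then $G$ has an odd $[1,b]$-factor, unless $G$ is isomorphic to $K_1\vee(K_{n-b-4}\cup K_3\cup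 bK_1)$, in which case $G$ has no odd $[1,b]$-factor. -/

import Mathlib

namespace BindingGraph

/-- The neighbourhood `N_G(X) = ⋃_{x ∈ X} N_G(x)` of a set `X` of vertices. -/
def nbhd {V : Type*} (G : SimpleGraph V) (X : Set V) : Set V :=
  ⋃ x ∈ X, G.neighborSet x

/-- The binding number `min {|N_G(X)| / |X| : ∅ ≠ X ⊆ V(G), N_G(X) ≠ V(G)}` of a finite graph.
When the vertex set is finite and nonempty, the infimum is over a finite nonempty set
(a singleton `X = {v}` qualifies, as `v ∉ N_G(v)`), so it is a minimum. -/
noncomputable def bindingNumber {V : Type*} (G : SimpleGraph V) : ℝ :=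
  sInf {r : ℝ | ∃ X : Set V, X.Nonempty ∧ nbhd G X ≠ Set.univ ∧
    r = ((nbhd G X).ncard : ℝ) / (X.ncard : ℝ)}

/-- `G` is `r`-binding if its binding number is at least `r`. -/
def IsBinding {V : Type*} (G : SimpleGraph V) (r : ℝ) : Prop :=
  r ≤ bindingNumber G

open Classical in
/-- The adjacency spectral radius: the largest eigenvalue of the (real symmetric) adjacency
matrix. For a nonempty vertex set the set of eigenvalues is finite and nonempty. -/
noncomputable def adjSpectralRadius {V : Type*} [Fintype V] (G : SimpleGraph V) : ℝ :=
  sSup {μ : ℝ | Module.End.HasEigenvalue (Matrix.toLin' (G.adjMatrix ℝ)) μ}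

/-- `G` has an odd `[1,b]`-factor (for odd `b`): a spanning subgraph `F` all of whose degrees lie
in `{1, 3, …, b}`. -/
def HasOddFactor {V : Type*} (G : SimpleGraph V) (b : ℕ) : Prop :=
  ∃ F : SimpleGraph V, F ≤ G ∧
    ∀ v : V, Odd (F.neighborSet v).ncard ∧ (F.neighborSet v).ncard ≤ b

/-- The join of two vertex-disjoint graphs: their disjoint union together with all edges between
the two parts. -/
def join {V W : Type*} (G : SimpleGraph V) (H : SimpleGraph W) : SimpleGraph (V ⊕ W) :=
  SimpleGraph.sum G H ⊔ completeBipartiteGraph V W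

/-- The graph `K_1 ∨ (K_m ∪ K_3 ∪ b K_1)`; `b K_1` is the graph on `b` vertices without edges. -/
def extremalGraph (m b : ℕ) : SimpleGraph (Fin 1 ⊕ ((Fin m ⊕ Fin 3) ⊕ Fin b)) :=
  join (⊤ : SimpleGraph (Fin 1))
    (SimpleGraph.sum (SimpleGraph.sum (⊤ : SimpleGraph (Fin m)) (⊤ : SimpleGraph (Fin 3)))
      (⊥ : SimpleGraph (Fin b)))

end BindingGraph

/-! Put m = n - b - 4. The extremal graph contains a clique on m + 1 vertices with further edges
leaving it, so its spectral radius exceeds m (`lt_adjSpectralRadius_extremalGraph`). Suppose G has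
no odd [1,b]-factor. Amahashi's criterion (`exists_barrier_of_not_hasOddFactor`) gives a set S, |S|
= s, whose removal leaves more than bs odd pieces. Parity raises this to bs + 2, and connectivity
makes S nonempty. The binding condition allows at most bs singleton pieces, because their neighbours
all lie in S. So at least two odd pieces have three or more vertices, and no piece exceeds n - s -
bs - 3.

A weighting that is constant on S and on each piece bounds the spectral radius of G in terms of s
and the piece sizes (`adjSpectralRadius_le_of_barrier`). The bound is at most m when s ≥ 2, and also
when s = 1 and every piece has fewer than m vertices; both contradict the hypothesis on ρ(G).
Otherwise s = 1 and the pieces have sizes m, 3, 1, ..., 1, so G is a spanning subgraph of the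
extremal graph. Strict monotonicity of the spectral radius (`eq_of_le_of_adjSpectralRadius_le`) then
makes the two equal.

Conversely, in an odd factor of the extremal graph each of the b + 2 odd pieces would need its own
edge to the centre. -/

namespace BindingGraph

/-! ### Spectral radius: Rayleigh quotients, supersolutions, strict monotonicity -/

section Spectral

open Classical Matrix

variable {V W : Type*} [Fintype V] [Fintype W]

theorem adjMatrix_mulVec_eq_sum (G : SimpleGraph V) (x : V → ℝ) (v : V) :
    (G.adjMatrix ℝ *ᵥ x) v = ∑ w, if G.Adj v w then x w else 0 := by
  simp only [mulVec, dotProduct, SimpleGraph.adjMatrix_apply, ite_mul, one_mul, zero_mul]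

theorem hasEigenvalue_adjMatrix_iff (G : SimpleGraph V) (μ : ℝ) :
    Module.End.HasEigenvalue (Matrix.toLin' (G.adjMatrix ℝ)) μ ↔
      ∃ x : V → ℝ, x ≠ 0 ∧ G.adjMatrix ℝ *ᵥ x = μ • x := by
  constructor
  · intro h
    obtain ⟨x, hx⟩ := h.exists_hasEigenvector
    exact ⟨x, hx.2, by simpa using hx.apply_eq_smul⟩
  · rintro ⟨x, hx, h⟩
    exact Module.End.hasEigenvalue_of_hasEigenvector
      ⟨Module.End.mem_eigenspace_iff.2 (by simpa using h), hx⟩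

theorem le_adjSpectralRadius (G : SimpleGraph V) {μ : ℝ} {x : V → ℝ} (hx : x ≠ 0)
    (h : G.adjMatrix ℝ *ᵥ x = μ • x) : μ ≤ adjSpectralRadius G :=
  le_csSup (Module.End.finite_hasEigenvalue _).bddAbove
    ((hasEigenvalue_adjMatrix_iff G μ).2 ⟨x, hx, h⟩)

theorem exists_eigenvector_adjSpectralRadius [Nonempty V] (G : SimpleGraph V) :
    ∃ x : V → ℝ, x ≠ 0 ∧ G.adjMatrix ℝ *ᵥ x = adjSpectralRadius G • x := by
  rw [← hasEigenvalue_adjMatrix_iff]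
  have hne : {μ : ℝ | Module.End.HasEigenvalue (Matrix.toLin' (G.adjMatrix ℝ)) μ}.Nonempty := by
    obtain ⟨j⟩ := ‹Nonempty V›
    have hA := SimpleGraph.isHermitian_adjMatrix ℝ G
    refine ⟨hA.eigenvalues j, (hasEigenvalue_adjMatrix_iff G _).2
      ⟨hA.eigenvectorBasis j, ?_, hA.mulVec_eigenvectorBasis j⟩⟩
    intro h0
    exact hA.eigenvectorBasis.orthonormal.ne_zero j (by ext i; exact congrFun h0 i)
  exact hne.csSup_mem (Module.End.finite_hasEigenvalue _)

theorem posSemidef_adjSpectralRadius_sub (G : SimpleGraph V) :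
    (adjSpectralRadius G • (1 : Matrix V V ℝ) - G.adjMatrix ℝ).PosSemidef := by
  have hA : (adjSpectralRadius G • (1 : Matrix V V ℝ) - G.adjMatrix ℝ).IsHermitian := by
    refine IsHermitian.sub ?_ (SimpleGraph.isHermitian_adjMatrix ℝ G)
    simp [IsHermitian]
  rw [hA.posSemidef_iff_eigenvalues_nonneg]
  intro j
  have h := hA.mulVec_eigenvectorBasis j
  have hne : (hA.eigenvectorBasis j : V → ℝ) ≠ 0 := by
    intro h0
    exact hA.eigenvectorBasis.orthonormal.ne_zero j (by ext i; exact congrFun h0 i)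
  have := le_adjSpectralRadius G (μ := adjSpectralRadius G - hA.eigenvalues j) hne (by
    rw [sub_smul, ← h, sub_mulVec, smul_mulVec, one_mulVec]
    abel)
  simpa using this

theorem dotProduct_adjMatrix_mulVec_le (G : SimpleGraph V) (x : V → ℝ) :
    x ⬝ᵥ G.adjMatrix ℝ *ᵥ x ≤ adjSpectralRadius G * (x ⬝ᵥ x) := by
  have := (posSemidef_adjSpectralRadius_sub G).dotProduct_mulVec_nonneg x
  simp only [star_trivial, sub_mulVec, smul_mulVec, one_mulVec, dotProduct_sub,
    dotProduct_smul, smul_eq_mul] at this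
  linarith

/-- The equality case of the Rayleigh bound: a positive semidefinite form vanishes only on its
kernel. -/
theorem adjMatrix_mulVec_eq_of_le_dotProduct (G : SimpleGraph V) {x : V → ℝ}
    (h : adjSpectralRadius G * (x ⬝ᵥ x) ≤ x ⬝ᵥ G.adjMatrix ℝ *ᵥ x) :
    G.adjMatrix ℝ *ᵥ x = adjSpectralRadius G • x := by
  have h0 := ((posSemidef_adjSpectralRadius_sub G).dotProduct_mulVec_zero_iff x).1 (by
    have := dotProduct_adjMatrix_mulVec_le G x
    simp only [star_trivial, sub_mulVec, smul_mulVec, one_mulVec, dotProduct_sub,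
      dotProduct_smul, smul_eq_mul]
    linarith)
  rw [sub_mulVec, smul_mulVec, one_mulVec, sub_eq_zero] at h0
  exact h0.symm

/-- The triangle inequality makes |x| a nonnegative subsolution, which does the work of a Perron
vector below. -/
theorem abs_mul_le_adjMatrix_mulVec_abs (G : SimpleGraph V) {μ : ℝ} {x : V → ℝ}
    (h : G.adjMatrix ℝ *ᵥ x = μ • x) (v : V) :
    μ * |x v| ≤ (G.adjMatrix ℝ *ᵥ fun w => |x w|) v := by
  have hv := congrFun h v
  rw [adjMatrix_mulVec_eq_sum, Pi.smul_apply, smul_eq_mul] at hv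
  calc μ * |x v| ≤ |μ| * |x v| := by gcongr; exact le_abs_self μ
    _ = |∑ w, if G.Adj v w then x w else 0| := by rw [hv, abs_mul]
    _ ≤ ∑ w, |if G.Adj v w then x w else 0| := Finset.abs_sum_le_sum_abs _ _
    _ = _ := by
      rw [adjMatrix_mulVec_eq_sum]
      refine Finset.sum_congr rfl fun w _ => ?_
      split_ifs <;> simp

/-- A positive vector `x` with `A x ≤ c x` bounds the spectral radius by `c`. -/
theorem adjSpectralRadius_le_of_supersolution [Nonempty V] (G : SimpleGraph V) {c : ℝ}
    {x : V → ℝ} (hx : ∀ v, 0 < x v)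
    (h : ∀ v, (∑ w, if G.Adj v w then x w else 0) ≤ c * x v) :
    adjSpectralRadius G ≤ c := by
  obtain ⟨y, hy0, hy⟩ := exists_eigenvector_adjSpectralRadius G
  have hpos : 0 < x ⬝ᵥ fun v => |y v| := by
    obtain ⟨v, hv⟩ := Function.ne_iff.1 hy0
    exact Finset.sum_pos' (fun w _ => mul_nonneg (hx w).le (abs_nonneg _))
      ⟨v, Finset.mem_univ _, mul_pos (hx v) (abs_pos.2 hv)⟩
  have h1 : adjSpectralRadius G * (x ⬝ᵥ fun v => |y v|) ≤
      x ⬝ᵥ G.adjMatrix ℝ *ᵥ fun v => |y v| := by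
    simp only [dotProduct, Finset.mul_sum]
    refine Finset.sum_le_sum fun v _ => ?_
    have := mul_le_mul_of_nonneg_left (abs_mul_le_adjMatrix_mulVec_abs G hy v) (hx v).le
    linarith
  have h2 : x ⬝ᵥ (G.adjMatrix ℝ *ᵥ fun v => |y v|) ≤ c * (x ⬝ᵥ fun v => |y v|) := by
    -- Symmetry of A moves it onto x, where the supersolution inequality applies.
    rw [dotProduct_mulVec, ← mulVec_transpose, G.isSymm_adjMatrix.eq]
    simp only [dotProduct, Finset.mul_sum]
    refine Finset.sum_le_sum fun v _ => ?_
    have := mul_le_mul_of_nonneg_right (h v) (abs_nonneg (y v))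
    rw [adjMatrix_mulVec_eq_sum]
    linarith
  exact le_of_mul_le_mul_right (h1.trans h2) hpos

theorem adjSpectralRadius_le_of_iso [Nonempty V] {G : SimpleGraph V} {H : SimpleGraph W}
    (e : G ≃g H) : adjSpectralRadius G ≤ adjSpectralRadius H := by
  obtain ⟨x, hx0, hx⟩ := exists_eigenvector_adjSpectralRadius G
  refine le_adjSpectralRadius H (x := x ∘ e.symm) ?_ ?_
  · intro h0
    refine hx0 (funext fun v => ?_)
    simpa using congrFun h0 (e v)
  · funext w
    have := congrFun hx (e.symm w)
    rw [adjMatrix_mulVec_eq_sum] at this ⊢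
    simp only [Pi.smul_apply, Function.comp] at this ⊢
    rw [← this]
    refine Fintype.sum_equiv e.symm.toEquiv _ _ fun u => ?_
    simp [SimpleGraph.Iso.map_adj_iff]

theorem adjSpectralRadius_congr [Nonempty V] {G : SimpleGraph V} {H : SimpleGraph W}
    (e : G ≃g H) : adjSpectralRadius G = adjSpectralRadius H :=
  have : Nonempty W := ⟨e (Classical.arbitrary V)⟩
  le_antisymm (adjSpectralRadius_le_of_iso e) (adjSpectralRadius_le_of_iso e.symm)

/-- Deleting edges from a connected graph strictly decreases its spectral radius. -/
theorem eq_of_le_of_adjSpectralRadius_le {G H : SimpleGraph V} (hH : H.Connected) (hGH : G ≤ H)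
    (h : adjSpectralRadius H ≤ adjSpectralRadius G) : G = H := by
  have := hH.nonempty
  obtain ⟨y, hy0, hy⟩ := exists_eigenvector_adjSpectralRadius G
  set x : V → ℝ := fun v => |y v| with hxdef
  have hx0 : ∀ v, 0 ≤ x v := fun v => abs_nonneg _
  have hGx : ∀ v, adjSpectralRadius G * x v ≤ (G.adjMatrix ℝ *ᵥ x) v :=
    abs_mul_le_adjMatrix_mulVec_abs G hy
  have hle : ∀ v, (G.adjMatrix ℝ *ᵥ x) v ≤ (H.adjMatrix ℝ *ᵥ x) v := fun v => by
    rw [adjMatrix_mulVec_eq_sum, adjMatrix_mulVec_eq_sum]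
    refine Finset.sum_le_sum fun w _ => ?_
    by_cases hvw : G.Adj v w
    · simp [hvw, hGH hvw]
    · rw [if_neg hvw]; split_ifs
      exacts [hx0 w, le_rfl]
  -- Here ρ(H)·xᵀx ≤ ρ(G)·xᵀx ≤ xᵀA_G x ≤ xᵀA_H x, so x attains the Rayleigh bound for H.
  have hHx : H.adjMatrix ℝ *ᵥ x = adjSpectralRadius H • x := by
    refine adjMatrix_mulVec_eq_of_le_dotProduct H ?_
    simp only [dotProduct, Finset.mul_sum]
    refine Finset.sum_le_sum fun v _ => ?_
    have h1 := mul_le_mul_of_nonneg_left ((hGx v).trans (hle v)) (hx0 v)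
    have h2 := mul_le_mul_of_nonneg_right h (mul_self_nonneg (x v))
    linarith
  have hpos : ∀ v, 0 < x v := by
    obtain ⟨v₀, hv₀⟩ := Function.ne_iff.1 hy0
    -- A zero of a nonnegative eigenvector forces zeros at all neighbours, so positivity spreads
    -- along walks.
    have hstep : ∀ u w, H.Adj u w → 0 < x u → 0 < x w := by
      intro u w huw hu
      by_contra hw
      have hw0 : x w = 0 := le_antisymm (not_lt.1 hw) (hx0 w)
      have := congrFun hHx w
      rw [adjMatrix_mulVec_eq_sum, Pi.smul_apply, hw0, smul_zero,
        Finset.sum_eq_zero_iff_of_nonneg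
          (fun i _ => by split_ifs; exacts [hx0 i, le_rfl])] at this
      have := this u (Finset.mem_univ _)
      rw [if_pos huw.symm] at this
      exact hu.ne' this
    intro v
    obtain ⟨p⟩ := hH.preconnected v₀ v
    have h0 : 0 < x v₀ := abs_pos.2 hv₀
    clear hv₀
    induction p with
    | nil => exact h0
    | cons hadj _ ih => exact ih (hstep _ _ hadj h0)
  refine le_antisymm hGH fun v w hvw => ?_
  by_contra hn
  have hlt : (G.adjMatrix ℝ *ᵥ x) v < (H.adjMatrix ℝ *ᵥ x) v := by
    rw [adjMatrix_mulVec_eq_sum, adjMatrix_mulVec_eq_sum]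
    refine Finset.sum_lt_sum (fun u _ => ?_) ⟨w, Finset.mem_univ _, ?_⟩
    · by_cases hvu : G.Adj v u
      · simp [hvu, hGH hvu]
      · rw [if_neg hvu]; split_ifs
        exacts [hx0 u, le_rfl]
    · rw [if_neg hn, if_pos hvw]
      exact hpos w
  have h1 := congrFun hHx v
  rw [Pi.smul_apply, smul_eq_mul] at h1
  have h2 := mul_le_mul_of_nonneg_right h (hx0 v)
  linarith [hGx v]

/-- A clique on more than `m` vertices which is not a union of connected components forces the
spectral radius to exceed `m`. -/
theorem lt_adjSpectralRadius_of_clique (G : SimpleGraph V) {m : ℕ} {K : Finset V}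
    (hK : G.IsClique (K : Set V)) (hcard : K.card = m + 1) {u v : V} (hu : u ∈ K) (hv : v ∉ K)
    (huv : G.Adj v u) : (m : ℝ) < adjSpectralRadius G := by
  by_contra hle
  rw [not_lt] at hle
  set x : V → ℝ := fun w => if w ∈ K then 1 else 0 with hx
  have hxx : x ⬝ᵥ x = m + 1 := by
    simp [hx, dotProduct, hcard]
  have hAx : ∀ w ∈ K, (m : ℝ) ≤ (G.adjMatrix ℝ *ᵥ x) w := by
    intro w hw
    rw [adjMatrix_mulVec_eq_sum]
    have : (m : ℝ) = ∑ z ∈ K.erase w, (1 : ℝ) := by simp [Finset.card_erase_of_mem hw, hcard]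
    rw [this]
    calc ∑ z ∈ K.erase w, (1 : ℝ) = ∑ z ∈ K.erase w, if G.Adj w z then x z else 0 := by
          refine Finset.sum_congr rfl fun z hz => ?_
          have hz' := Finset.mem_erase.1 hz
          rw [if_pos (hK hw hz'.2 (Ne.symm hz'.1))]
          simp [hx, hz'.2]
      _ ≤ _ := Finset.sum_le_sum_of_subset_of_nonneg (Finset.subset_univ _) fun i _ _ => by
          simp only [hx]; split_ifs <;> norm_num
  have hge : (m : ℝ) * (m + 1) ≤ x ⬝ᵥ G.adjMatrix ℝ *ᵥ x := by
    have : x ⬝ᵥ G.adjMatrix ℝ *ᵥ x = ∑ w ∈ K, (G.adjMatrix ℝ *ᵥ x) w := by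
      simp [hx, dotProduct]
    rw [this]
    have h := Finset.card_nsmul_le_sum K _ _ hAx
    rw [hcard, nsmul_eq_mul] at h
    push_cast at h
    linarith
  -- If ρ ≤ m, the indicator of K attains the Rayleigh bound and is an eigenvector. This fails at v,
  -- where it vanishes although the neighbour u contributes 1.
  have heig := adjMatrix_mulVec_eq_of_le_dotProduct G (x := x) (by
    rw [hxx]
    refine le_trans ?_ hge
    exact mul_le_mul_of_nonneg_right hle (by positivity))
  have h0 := congrFun heig v
  rw [adjMatrix_mulVec_eq_sum, Pi.smul_apply, show x v = 0 by simp [hx, hv], smul_zero,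
    Finset.sum_eq_zero_iff_of_nonneg
      (fun i _ => by simp only [hx]; split_ifs <;> norm_num)] at h0
  have := h0 u (Finset.mem_univ _)
  rw [if_pos huv] at this
  simp [hx, hu] at this

end Spectral

/-! ### Odd factors from perfect matchings of a clique blow-up -/

section OddFactor

open Classical

/-- The lexicographic product of `G` with the complete graph on `b` vertices. -/
def cliqueBlowup {V : Type*} (G : SimpleGraph V) (b : ℕ) : SimpleGraph (V × Fin b) where
  Adj p q := G.Adj p.1 q.1 ∨ (p.1 = q.1 ∧ p.2 ≠ q.2)
  symm := ⟨fun _ _ h => h.elim (fun h => Or.inl h.symm) fun h => Or.inr ⟨h.1.symm, h.2.symm⟩⟩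
  loopless := ⟨fun _ h => h.elim (fun h => G.loopless.irrefl _ h) fun h => h.2 rfl⟩

/-- Let `cnt v w` count the matching edges between the fibres of v and w. This is symmetric, even on
the diagonal, and has row sums b. Keeping the pairs with odd count therefore gives odd degrees at
most b. -/
theorem hasOddFactor_of_isPerfectMatching {V : Type*} [Fintype V] {G : SimpleGraph V} {b : ℕ}
    (hb : Odd b) {M : (cliqueBlowup G b).Subgraph} (hM : M.IsPerfectMatching) :
    HasOddFactor G b := by
  have hex : ∀ p, ∃ q, M.Adj p q := fun p => (hM.1 (hM.2 p)).exists
  choose m hm using hex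
  have hmm : ∀ p, m (m p) = p := fun p =>
    hM.1.eq_of_adj_left (hm (m p)) (hm p).symm
  let cnt : V → V → ℕ := fun v w => (Finset.univ.filter fun i : Fin b => (m (v, i)).1 = w).card
  have hle : ∀ v w, cnt v w ≤ cnt w v := fun v w => by
    refine Finset.card_le_card_of_injOn (fun i => (m (v, i)).2) (fun i hi => ?_)
      fun i hi j hj hij => ?_
    · simp only [Finset.coe_filter, Finset.mem_univ, true_and, Set.mem_ofPred_eq] at hi ⊢
      rw [show (w, (m (v, i)).2) = m (v, i) from Prod.ext hi.symm rfl, hmm]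
    · simp only [Finset.coe_filter, Finset.mem_univ, true_and, Set.mem_ofPred_eq] at hi hj
      have h : m (v, i) = m (v, j) := Prod.ext (hi.trans hj.symm) hij
      have := congrArg m h
      rw [hmm, hmm] at this
      exact congrArg Prod.snd this
  have hself : ∀ v, Even (cnt v v) := fun v => by
    have h0 : ∑ i ∈ Finset.univ.filter (fun i : Fin b => (m (v, i)).1 = v), (1 : ZMod 2) = 0 := by
      have key : ∀ i, (m (v, i)).1 = v → (v, (m (v, i)).2) = m (v, i) :=
        fun i hi => Prod.ext hi.symm rfl
      -- Matching partners inside one fibre form a fixed-point-free involution.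
      refine Finset.sum_involution (fun i _ => (m (v, i)).2) (fun _ _ => by decide)
        (fun i hi _ h => ?_) (fun i hi => ?_) fun i hi => ?_
      · have hi' := (Finset.mem_filter.1 hi).2
        have h2 := key i hi'
        rw [h] at h2
        have h3 := hm (v, i)
        rw [← h2] at h3
        exact M.loopless.irrefl _ h3
      · have hi' := (Finset.mem_filter.1 hi).2
        rw [Finset.mem_filter, key i hi', hmm]
        exact ⟨Finset.mem_univ _, rfl⟩
      · have hi' := (Finset.mem_filter.1 hi).2
        simp only [key i hi', hmm]
    rw [Finset.sum_const, nsmul_one] at h0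
    exact (ZMod.natCast_eq_zero_iff_even).1 h0
  have hsum : ∀ v, ∑ w, cnt v w = b := fun v => by
    have := Finset.card_eq_sum_card_fiberwise (s := (Finset.univ : Finset (Fin b)))
      (t := (Finset.univ : Finset V)) (f := fun i => (m (v, i)).1) (fun _ _ => Finset.mem_univ _)
    rw [Finset.card_univ, Fintype.card_fin] at this
    exact this.symm
  let F : SimpleGraph V :=
    { Adj := fun v w => Odd (cnt v w)
      symm := ⟨fun v w h => by rwa [le_antisymm (hle w v) (hle v w)]⟩
      loopless := ⟨fun v h => Nat.not_even_iff_odd.2 h (hself v)⟩ }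
  refine ⟨F, fun v w h => ?_, fun v => ?_⟩
  · have hne : v ≠ w := F.ne_of_adj h
    obtain ⟨i, hi⟩ := Finset.card_pos.1 (Odd.pos (show Odd (cnt v w) from h))
    have hi' := (Finset.mem_filter.1 hi).2
    rcases M.adj_sub (hm (v, i)) with h1 | h1
    · rwa [hi'] at h1
    · exact absurd (h1.1.trans hi') hne
  · have hdeg : (F.neighborSet v).ncard = (Finset.univ.filter fun w => Odd (cnt v w)).card := by
      rw [← Set.ncard_coe_finset]
      congr 1
      ext w
      simp [F]
    rw [hdeg]
    constructor
    · rw [← Finset.odd_sum_iff_odd_card_odd, hsum]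
      exact hb
    · calc _ = ∑ w ∈ Finset.univ.filter (fun w => Odd (cnt v w)), 1 := by simp
        _ ≤ ∑ w ∈ Finset.univ.filter (fun w => Odd (cnt v w)), cnt v w :=
          Finset.sum_le_sum fun w hw => (Finset.mem_filter.1 hw).2.pos
        _ ≤ ∑ w, cnt v w := Finset.sum_le_sum_of_subset (Finset.filter_subset _ _)
        _ = b := hsum v

/-- The nontrivial direction of Amahashi's odd `[1,b]`-factor theorem: a graph without an odd
`[1,b]`-factor has a vertex set `S` whose removal leaves more than `b |S|` odd pieces. -/
theorem exists_barrier_of_not_hasOddFactor.{u} {V : Type u} [Fintype V] {G : SimpleGraph V} {b : ℕ}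
    (hb : Odd b) (h : ¬ HasOddFactor G b) :
    ∃ (S : Finset V) (κ : Type u) (_ : Fintype κ) (f : V → κ),
      (∀ u v, u ∉ S → v ∉ S → G.Adj u v → f u = f v) ∧
      b * S.card < (Finset.univ.filter fun k : κ =>
        Odd (Finset.univ.filter fun v => v ∉ S ∧ f v = k).card).card := by
  have hT : ∃ U, (cliqueBlowup G b).IsTutteViolator U := by
    by_contra hno
    obtain ⟨M, hM⟩ := SimpleGraph.tutte.2 (not_exists.1 hno)
    exact h (hasOddFactor_of_isPerfectMatching hb hM)
  obtain ⟨U, hU⟩ := hT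
  unfold SimpleGraph.IsTutteViolator at hU
  set D := ((⊤ : (cliqueBlowup G b).Subgraph).deleteVerts U).coe with hD
  have hmem : ∀ p, p ∉ U → p ∈ ((⊤ : (cliqueBlowup G b).Subgraph).deleteVerts U).verts :=
    fun p hp => ⟨trivial, hp⟩
  have hadj : ∀ p q (hp : p ∉ U) (hq : q ∉ U), (cliqueBlowup G b).Adj p q →
      D.connectedComponentMk ⟨p, hmem p hp⟩ = D.connectedComponentMk ⟨q, hmem q hq⟩ := by
    intro p q hp hq hpq
    refine SimpleGraph.ConnectedComponent.connectedComponentMk_eq_of_adj ?_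
    simp [hD, hp, hq, hpq]
  have hfin : Finite D.ConnectedComponent := inferInstance
  have hfint : Fintype D.ConnectedComponent := Fintype.ofFinite _
  have hne : Nonempty D.ConnectedComponent := by
    obtain ⟨C, -⟩ := Set.nonempty_of_ncard_ne_zero (Nat.ne_of_gt (lt_of_le_of_lt (Nat.zero_le _) hU))
    exact ⟨C⟩
  -- S collects the vertices whose whole fibre is deleted. Any other fibre keeps a point, and its
  -- surviving points form a clique, so they lie in a single component, which serves as the label.
  set S : Finset V := Finset.univ.filter fun v => ∀ i, (v, i) ∈ U with hS
  have hnS : ∀ v, v ∉ S → ∃ i, (v, i) ∉ U := by simp [hS]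
  choose g hg using hnS
  set f : V → D.ConnectedComponent := fun v =>
    if hv : v ∉ S then D.connectedComponentMk ⟨(v, g v hv), hmem _ (hg v hv)⟩
    else Classical.arbitrary _ with hf
  have hfS : ∀ v i (hvi : (v, i) ∉ U), v ∉ S ∧
      D.connectedComponentMk ⟨(v, i), hmem _ hvi⟩ = f v := by
    intro v i hvi
    have hv : v ∉ S := by
      simp only [hS, Finset.mem_filter, Finset.mem_univ, true_and, not_forall]
      exact ⟨i, hvi⟩
    refine ⟨hv, ?_⟩
    simp only [hf, dif_pos hv]
    by_cases hi : i = g v hv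
    · subst hi; rfl
    · exact hadj _ _ hvi (hg v hv) (Or.inr ⟨rfl, hi⟩)
  refine ⟨S, D.ConnectedComponent, hfint, f, fun u v hu hv huv => ?_, ?_⟩
  · simp only [hf, dif_pos hu, dif_pos hv]
    exact hadj _ _ (hg u hu) (hg v hv) (Or.inl huv)
  · set c : D.ConnectedComponent → ℕ := fun k =>
      (Finset.univ.filter fun v => v ∉ S ∧ f v = k).card with hc
    have hcount : ∀ C : D.ConnectedComponent, c C * b = C.supp.ncard +
        (Finset.univ.filter fun p : V × Fin b => p ∈ U ∧ p.1 ∉ S ∧ f p.1 = C).card := by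
      intro C
      have h1 : c C * b = ((Finset.univ.filter fun v => v ∉ S ∧ f v = C) ×ˢ
          (Finset.univ : Finset (Fin b))).card := by
        rw [Finset.card_product, Finset.card_univ, Fintype.card_fin]
      have h2 : C.supp.ncard =
          (Finset.univ.filter fun p : V × Fin b => p ∉ U ∧ p.1 ∉ S ∧ f p.1 = C).card := by
        rw [← Set.ncard_image_of_injective _ Subtype.val_injective, ← Set.ncard_coe_finset]
        congr 1
        ext ⟨v, i⟩
        simp only [Set.mem_image, SimpleGraph.ConnectedComponent.mem_supp_iff, Subtype.exists,
          exists_and_right, exists_eq_right, Finset.coe_filter, Finset.mem_univ, true_and,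
          Set.mem_ofPred_eq]
        constructor
        · rintro ⟨hx, hxC⟩
          have hvi : (v, i) ∉ U := hx.2
          exact ⟨hvi, (hfS v i hvi).1, (hfS v i hvi).2.symm.trans hxC⟩
        · rintro ⟨hvi, -, hxC⟩
          exact ⟨hmem _ hvi, (hfS v i hvi).2.trans hxC⟩
      rw [h1, h2, ← Finset.card_union_of_disjoint]
      · congr 1
        ext p
        simp only [Finset.mem_product, Finset.mem_filter, Finset.mem_univ, true_and, and_true,
          Finset.mem_union]
        tauto
      · rw [Finset.disjoint_left]
        intro p hp hp'
        exact (Finset.mem_filter.1 hp).2.1 (Finset.mem_filter.1 hp').2.1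
    -- As b·c(C) is |C| plus the number of deleted points with label C outside the fibres of S, an
    -- odd component C with c(C) even owns such a point. These points number |U| - b|S|, so more
    -- than b|S| labels have c odd.
    have hsub : D.oddComponents.toFinset ⊆ (Finset.univ.filter fun k => Odd (c k)) ∪
        (Finset.univ.filter fun p : V × Fin b => p ∈ U ∧ p.1 ∉ S).image (fun p => f p.1) := by
      intro C hC
      have hC' : Odd C.supp.ncard := by simpa using hC
      rw [Finset.mem_union, Finset.mem_filter, Finset.mem_image]
      by_cases hodd : Odd (c C)
      · exact Or.inl ⟨Finset.mem_univ _, hodd⟩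
      · right
        have hev : Even (c C * b) := (Nat.not_odd_iff_even.1 hodd).mul_right b
        rw [hcount C] at hev
        have hpos : Odd (Finset.univ.filter fun p : V × Fin b =>
            p ∈ U ∧ p.1 ∉ S ∧ f p.1 = C).card := by
          by_contra hne'
          exact Nat.not_even_iff_odd.2 (hC'.add_even (Nat.not_odd_iff_even.1 hne')) hev
        obtain ⟨p, hp⟩ := Finset.card_pos.1 hpos.pos
        have hp' := (Finset.mem_filter.1 hp).2
        exact ⟨p, Finset.mem_filter.2 ⟨Finset.mem_univ _, hp'.1, hp'.2.1⟩, hp'.2.2⟩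
    have hUcard : U.ncard = S.card * b +
        (Finset.univ.filter fun p : V × Fin b => p ∈ U ∧ p.1 ∉ S).card := by
      have h1 : S.card * b = (S ×ˢ (Finset.univ : Finset (Fin b))).card := by
        rw [Finset.card_product, Finset.card_univ, Fintype.card_fin]
      rw [h1, ← Finset.card_union_of_disjoint, ← Set.ncard_coe_finset]
      · congr 1
        ext ⟨v, i⟩
        simp only [Finset.coe_union, Finset.coe_product, Finset.coe_univ, Finset.coe_filter,
          Finset.mem_univ, true_and, Set.mem_union, Set.mem_prod, Finset.mem_coe, Set.mem_univ,
          and_true, Set.mem_ofPred_eq]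
        constructor
        · intro hvi
          by_cases hv : v ∈ S
          · exact Or.inl hv
          · exact Or.inr ⟨hvi, hv⟩
        · rintro (hv | hv)
          · exact (Finset.mem_filter.1 hv).2 i
          · exact hv.1
      · rw [Finset.disjoint_left]
        intro p hp hp'
        exact (Finset.mem_filter.1 hp').2.2 (Finset.mem_product.1 hp).1
    rw [hUcard, Set.ncard_eq_toFinset_card'] at hU
    have h1 := Finset.card_le_card hsub
    have h2 := Finset.card_union_le (Finset.univ.filter fun k => Odd (c k))
      ((Finset.univ.filter fun p : V × Fin b => p ∈ U ∧ p.1 ∉ S).image (fun p => f p.1))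
    have h3 := Finset.card_image_le (s := Finset.univ.filter fun p : V × Fin b => p ∈ U ∧ p.1 ∉ S)
      (f := fun p => f p.1)
    change b * S.card < (Finset.univ.filter fun k => Odd (c k)).card
    rw [Nat.mul_comm]
    omega

end OddFactor

/-! ### Barriers: piece counts and spectral bounds -/

section Barrier

open Classical

variable {V κ : Type*} [Fintype V] [Fintype κ]

/-- The number of vertices outside `S` with label `k`. -/
noncomputable def pieceCard (S : Finset V) (f : V → κ) (k : κ) : ℕ :=
  (Finset.univ.filter fun v => v ∉ S ∧ f v = k).card

omit [Fintype κ] in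
theorem pieceCard_eq (S : Finset V) (f : V → κ) (k : κ) :
    pieceCard S f k = (Sᶜ.filter fun v => f v = k).card := by
  unfold pieceCard
  congr 1
  ext v
  simp

theorem sum_pieceCard (S : Finset V) (f : V → κ) :
    ∑ k, pieceCard S f k = Fintype.card V - S.card := by
  simp only [pieceCard_eq]
  rw [← Finset.card_compl]
  exact (Finset.card_eq_sum_card_fiberwise fun _ _ => Finset.mem_univ _).symm

/-- In a connected graph of even order, a barrier is nonempty, and by parity it leaves at least
`b |S| + 2` odd pieces. -/
theorem barrier_nonempty_and_add_two_le {G : SimpleGraph V} {b : ℕ} (hb : Odd b)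
    (heven : Even (Fintype.card V)) (hconn : G.Connected) {S : Finset V} {f : V → κ}
    (hf : ∀ u v, u ∉ S → v ∉ S → G.Adj u v → f u = f v)
    (hlt : b * S.card < (Finset.univ.filter fun k => Odd (pieceCard S f k)).card) :
    0 < S.card ∧ b * S.card + 2 ≤ (Finset.univ.filter fun k => Odd (pieceCard S f k)).card := by
  have h2 : b * S.card + 2 ≤ (Finset.univ.filter fun k => Odd (pieceCard S f k)).card := by
    -- The number of odd pieces has the parity of n - s, which is that of bs since n is even and b
    -- odd; so it is not bs + 1.
    have hpar := Finset.odd_sum_iff_odd_card_odd (s := Finset.univ) (pieceCard S f)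
    rw [sum_pieceCard] at hpar
    have hle := S.card_le_univ
    by_contra hlt'
    have heq : (Finset.univ.filter fun k => Odd (pieceCard S f k)).card = b * S.card + 1 := by
      omega
    rw [heq] at hpar
    rcases Nat.even_or_odd S.card with hs | hs
    · have h1 : Even (b * S.card) := hs.mul_left b
      have : Odd (Fintype.card V - S.card) := hpar.2 h1.add_one
      exact Nat.not_even_iff_odd.2 this ((Nat.even_sub hle).2 (by tauto))
    · have h1 : Odd (b * S.card) := hb.mul hs
      have : Odd (Fintype.card V - S.card) :=
        (Nat.odd_sub hle).2 ⟨fun h => absurd heven (Nat.not_even_iff_odd.2 h),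
          fun h => absurd hs (Nat.not_odd_iff_even.2 h)⟩
      exact Nat.not_even_iff_odd.2 (hpar.1 this) h1.add_one
  refine ⟨?_, h2⟩
  by_contra h0
  have hS : S = ∅ := Finset.card_eq_zero.1 (by omega)
  subst hS
  have hconst : ∀ u v, f u = f v := by
    intro u v
    obtain ⟨p⟩ := hconn.preconnected u v
    induction p with
    | nil => rfl
    | cons hadj _ ih => exact (hf _ _ (by simp) (by simp) hadj).trans ih
  obtain ⟨k, hk, l, hl, hkl⟩ := Finset.one_lt_card.1 (lt_of_lt_of_le (by omega) h2)
  obtain ⟨u, hu⟩ := Finset.card_pos.1 (Finset.mem_filter.1 hk).2.pos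
  obtain ⟨v, hv⟩ := Finset.card_pos.1 (Finset.mem_filter.1 hl).2.pos
  exact hkl ((Finset.mem_filter.1 hu).2.2.symm.trans
    ((hconst u v).trans (Finset.mem_filter.1 hv).2.2))

theorem IsBinding.card_le_mul_ncard_nbhd {G : SimpleGraph V} {b : ℕ} (hb : 0 < b)
    (h : IsBinding G (1 / (b : ℝ))) {X : Set V} (hN : nbhd G X ≠ Set.univ) :
    X.ncard ≤ b * (nbhd G X).ncard := by
  rcases X.eq_empty_or_nonempty with rfl | hX
  · simp
  have hle : 1 / (b : ℝ) ≤ ((nbhd G X).ncard : ℝ) / (X.ncard : ℝ) := by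
    refine h.trans (csInf_le ⟨0, ?_⟩ ⟨X, hX, hN, rfl⟩)
    rintro _ ⟨Y, -, -, rfl⟩
    positivity
  have hXpos : (0 : ℝ) < X.ncard := by exact_mod_cast (Set.ncard_pos).2 hX
  rw [div_le_div_iff₀ (by exact_mod_cast hb) hXpos, one_mul] at hle
  rw [mul_comm]
  exact_mod_cast hle

/-- The vertices forming singleton pieces have all their neighbours in S, so the binding inequality
applies to the set of them. -/
theorem card_singleton_pieces_le {G : SimpleGraph V} {b : ℕ} (hb : 0 < b)
    (h : IsBinding G (1 / (b : ℝ))) {S : Finset V} {f : V → κ}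
    (hf : ∀ u v, u ∉ S → v ∉ S → G.Adj u v → f u = f v) (hS : S ≠ Finset.univ) :
    (Finset.univ.filter fun k => pieceCard S f k = 1).card ≤ b * S.card := by
  set I : Finset V := Finset.univ.filter fun v => v ∉ S ∧ pieceCard S f (f v) = 1 with hI
  have hN : nbhd G (I : Set V) ⊆ S := by
    intro w hw
    simp only [nbhd, Set.mem_iUnion] at hw
    obtain ⟨v, hv, hvw⟩ := hw
    have hv' := (Finset.mem_filter.1 (Finset.mem_coe.1 hv)).2
    by_contra hwS
    have hwS' : w ∉ S := hwS
    obtain ⟨a, ha⟩ := Finset.card_eq_one.1 hv'.2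
    have h1 : v ∈ ({a} : Finset V) := ha ▸ Finset.mem_filter.2 ⟨Finset.mem_univ _, hv'.1, rfl⟩
    have h2 : w ∈ ({a} : Finset V) := ha ▸ Finset.mem_filter.2
      ⟨Finset.mem_univ _, hwS', (hf _ _ hv'.1 hwS' hvw).symm⟩
    rw [Finset.mem_singleton] at h1 h2
    exact G.ne_of_adj hvw (h1.trans h2.symm)
  have hNu : nbhd G (I : Set V) ≠ Set.univ := by
    intro hu
    refine hS (Finset.eq_univ_iff_forall.2 fun v => ?_)
    exact hN (hu ▸ Set.mem_univ v)
  have h1 := h.card_le_mul_ncard_nbhd hb hNu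
  have h2 : (nbhd G (I : Set V)).ncard ≤ S.card := by
    rw [← Set.ncard_coe_finset S]
    exact Set.ncard_le_ncard hN
  rw [Set.ncard_coe_finset] at h1
  have h3 : (Finset.univ.filter fun k => pieceCard S f k = 1).card ≤ I.card := by
    refine (Finset.card_le_card fun k hk => ?_).trans (Finset.card_image_le (f := f))
    have hk' := (Finset.mem_filter.1 hk).2
    obtain ⟨v, hv⟩ := Finset.card_pos.1 (hk'.symm ▸ one_pos : 0 < pieceCard S f k)
    have hv' := (Finset.mem_filter.1 hv).2
    exact Finset.mem_image.2 ⟨v, Finset.mem_filter.2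
      ⟨Finset.mem_univ _, hv'.1, by rw [hv'.2]; exact hk'⟩, hv'.2⟩
  exact h3.trans (h1.trans (Nat.mul_le_mul_left b h2))

omit V in
-- At least two odd pieces are not singletons, so one of them differs from any prescribed k. At
-- least t odd pieces remain besides these two, each with a vertex.
theorem exists_second_piece {c : κ → ℕ} {t : ℕ}
    (hodd : t + 2 ≤ (Finset.univ.filter fun k => Odd (c k)).card)
    (hone : (Finset.univ.filter fun k => c k = 1).card ≤ t) (k : κ) :
    ∃ l, l ≠ k ∧ 3 ≤ c l ∧ t ≤ (Finset.univ.filter fun j => j ≠ k ∧ j ≠ l ∧ 0 < c j).card ∧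
      c k + c l + t ≤ ∑ j, c j := by
  set O := Finset.univ.filter fun k => Odd (c k) with hO
  set I := Finset.univ.filter fun k => c k = 1 with hI
  have hcard : 1 < (O \ I).card := by
    have := Finset.le_card_sdiff I O
    omega
  obtain ⟨l, hl, hlk⟩ := Finset.exists_mem_ne hcard k
  rw [Finset.mem_sdiff, hO, hI, Finset.mem_filter, Finset.mem_filter] at hl
  have hl3 : 3 ≤ c l := by
    obtain ⟨⟨-, r, hr⟩, h1⟩ := hl
    have : c l ≠ 1 := fun h => h1 ⟨Finset.mem_univ _, h⟩
    omega
  set R := Finset.univ.filter fun j => j ≠ k ∧ j ≠ l ∧ 0 < c j with hR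
  have hRt : t ≤ R.card := by
    have h1 : (O.erase k).erase l ⊆ R := by
      intro j hj
      rw [Finset.mem_erase, Finset.mem_erase, hO, Finset.mem_filter] at hj
      exact Finset.mem_filter.2 ⟨Finset.mem_univ _, hj.2.1, hj.1, hj.2.2.2.pos⟩
    have h2 := Finset.card_le_card h1
    have h3 := Finset.pred_card_le_card_erase (s := O) (a := k)
    have h4 := Finset.pred_card_le_card_erase (s := O.erase k) (a := l)
    omega
  refine ⟨l, hlk, hl3, hRt, ?_⟩
  have hk : k ∉ insert l R := by
    rw [Finset.mem_insert, hR, Finset.mem_filter]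
    rintro (h | h)
    · exact hlk h.symm
    · exact h.2.1 rfl
  have hl' : l ∉ R := by
    rw [hR, Finset.mem_filter]
    exact fun h => h.2.2.1 rfl
  have hsum : R.card ≤ ∑ j ∈ R, c j := by
    rw [Finset.card_eq_sum_ones]
    exact Finset.sum_le_sum fun j hj => (Finset.mem_filter.1 hj).2.2.2
  have := Finset.sum_le_sum_of_subset (f := c) (Finset.subset_univ (insert k (insert l R)))
  rw [Finset.sum_insert hk, Finset.sum_insert hl'] at this
  omega

theorem sum_compl_eq_sum_pieceCard_mul (S : Finset V) (f : V → κ) (g : ℕ → ℝ) :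
    ∑ v ∈ Sᶜ, g (pieceCard S f (f v)) = ∑ k, (pieceCard S f k : ℝ) * g (pieceCard S f k) := by
  rw [← Finset.sum_fiberwise Sᶜ f]
  refine Finset.sum_congr rfl fun k _ => ?_
  have h : ∀ v ∈ Sᶜ.filter (fun v => f v = k), g (pieceCard S f (f v)) = g (pieceCard S f k) :=
    fun v hv => by rw [(Finset.mem_filter.1 hv).2]
  rw [Finset.sum_congr rfl h, Finset.sum_const, nsmul_eq_mul, ← pieceCard_eq]

omit [Fintype κ] in
-- The worst case is a clique on S joined to disjoint cliques. Weight 1 on S and s / (r + 1 - c) on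
-- a piece of size c solves that graph's eigenvalue equation for r outside S exactly; `hr` is the
-- remaining inequality on S.
theorem adjSpectralRadius_le_of_barrier {G : SimpleGraph V} {S : Finset V} {f : V → κ}
    (hf : ∀ u v, u ∉ S → v ∉ S → G.Adj u v → f u = f v) (hS : 0 < S.card) {r : ℝ}
    (hc : ∀ v ∉ S, (pieceCard S f (f v) : ℝ) < r + 1)
    (hr : ∑ v ∈ Sᶜ, (S.card : ℝ) / (r + 1 - pieceCard S f (f v)) + S.card - 1 ≤ r) :
    adjSpectralRadius G ≤ r := by
  obtain ⟨z, hz⟩ := Finset.card_pos.1 hS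
  have : Nonempty V := ⟨z⟩
  set x : V → ℝ := fun v => if v ∈ S then 1 else (S.card : ℝ) / (r + 1 - pieceCard S f (f v))
    with hx
  have hxpos : ∀ v, 0 < x v := by
    intro v
    by_cases hv : v ∈ S
    · simp [hx, hv]
    · simp only [hx, if_neg hv]
      exact div_pos (by exact_mod_cast hS) (by linarith [hc v hv])
  have hsplit : ∀ v, (∑ w, if G.Adj v w then x w else 0) =
      (∑ w ∈ S, if G.Adj v w then x w else 0) + ∑ w ∈ Sᶜ, if G.Adj v w then x w else 0 :=
    fun v => (Finset.sum_add_sum_compl S _).symm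
  refine adjSpectralRadius_le_of_supersolution G hxpos fun v => ?_
  rw [hsplit]
  by_cases hv : v ∈ S
  · have h1 : (∑ w ∈ S, if G.Adj v w then x w else 0) ≤ S.card - 1 := by
      have : (∑ w ∈ S, if G.Adj v w then x w else 0) ≤ ∑ w ∈ S.erase v, (1 : ℝ) := by
        rw [← Finset.add_sum_erase S _ hv, if_neg (G.loopless.irrefl v), zero_add]
        refine Finset.sum_le_sum fun w hw => ?_
        have hw' := (Finset.mem_erase.1 hw).2
        simp only [hx, if_pos hw']
        split_ifs <;> norm_num
      refine this.trans (le_of_eq ?_)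
      rw [Finset.sum_const, Finset.card_erase_of_mem hv, nsmul_eq_mul, mul_one,
        Nat.cast_sub (Nat.one_le_of_lt hS), Nat.cast_one]
    have h2 : (∑ w ∈ Sᶜ, if G.Adj v w then x w else 0) ≤
        ∑ w ∈ Sᶜ, (S.card : ℝ) / (r + 1 - pieceCard S f (f w)) := by
      refine Finset.sum_le_sum fun w hw => ?_
      have hw' := Finset.mem_compl.1 hw
      have hxw : x w = (S.card : ℝ) / (r + 1 - pieceCard S f (f w)) := by
        simp only [hx, if_neg hw']
      rw [← hxw]
      split_ifs
      exacts [le_rfl, (hxpos w).le]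
    have h3 : x v = 1 := by simp [hx, hv]
    rw [h3]
    linarith
  · have hden : 0 < r + 1 - pieceCard S f (f v) := by linarith [hc v hv]
    have hxv : x v = (S.card : ℝ) / (r + 1 - pieceCard S f (f v)) := by
      simp only [hx, if_neg hv]
    have h1 : (∑ w ∈ S, if G.Adj v w then x w else 0) ≤ S.card := by
      have : (∑ w ∈ S, if G.Adj v w then x w else 0) ≤ ∑ w ∈ S, (1 : ℝ) := by
        refine Finset.sum_le_sum fun w hw => ?_
        simp only [hx, if_pos hw]
        split_ifs <;> norm_num
      simpa using this
    have h2 : (∑ w ∈ Sᶜ, if G.Adj v w then x w else 0) ≤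
        ((pieceCard S f (f v) : ℝ) - 1) * x v := by
      set T := Sᶜ.filter fun w => f w = f v with hT
      have hvT : v ∈ T := Finset.mem_filter.2 ⟨Finset.mem_compl.2 hv, rfl⟩
      have hcard : ((T.erase v).card : ℝ) = (pieceCard S f (f v) : ℝ) - 1 := by
        rw [pieceCard_eq, Finset.card_erase_of_mem hvT,
          Nat.cast_sub (Finset.card_pos.2 ⟨v, hvT⟩), Nat.cast_one]
      rw [← hcard, ← nsmul_eq_mul, ← Finset.sum_const, ← Finset.sum_filter]
      refine (Finset.sum_le_sum_of_subset_of_nonneg (t := T.erase v) (fun w hw => ?_)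
        fun w _ _ => (hxpos w).le).trans (le_of_eq (Finset.sum_congr rfl fun w hw => ?_))
      · obtain ⟨hw1, hw2⟩ := Finset.mem_filter.1 hw
        exact Finset.mem_erase.2 ⟨(G.ne_of_adj hw2).symm, Finset.mem_filter.2
          ⟨hw1, (hf _ _ hv (Finset.mem_compl.1 hw1) hw2).symm⟩⟩
      · obtain ⟨hw1, hw2⟩ := Finset.mem_filter.1 (Finset.mem_erase.1 hw).2
        simp only [hx, if_neg hv, if_neg (Finset.mem_compl.1 hw1), hw2]
    have h3 : x v * (r + 1 - pieceCard S f (f v)) = S.card := by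
      rw [hxv, div_mul_cancel₀ _ hden.ne']
    linarith

omit [Fintype κ] in
-- Every denominator in the barrier bound is replaced by its least possible value r + 1 - K.
theorem adjSpectralRadius_le_of_pieceCard_le {G : SimpleGraph V} {S : Finset V} {f : V → κ}
    (hf : ∀ u v, u ∉ S → v ∉ S → G.Adj u v → f u = f v) (hS : 0 < S.card) {r K : ℝ}
    (hc : ∀ k, (pieceCard S f k : ℝ) ≤ K) (hK : K < r + 1)
    (hr : ((Fintype.card V : ℝ) - S.card) * S.card ≤ (r + 1 - S.card) * (r + 1 - K)) :
    adjSpectralRadius G ≤ r := by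
  have hK' : 0 < r + 1 - K := by linarith
  refine adjSpectralRadius_le_of_barrier hf hS (fun v _ => (hc _).trans_lt hK) ?_
  have h1 : ∑ v ∈ Sᶜ, (S.card : ℝ) / (r + 1 - pieceCard S f (f v)) ≤
      ∑ v ∈ Sᶜ, (S.card : ℝ) / (r + 1 - K) := by
    refine Finset.sum_le_sum fun v _ => ?_
    have := hc (f v)
    gcongr
  have h2 : ∑ v ∈ Sᶜ, (S.card : ℝ) / (r + 1 - K) ≤ r + 1 - S.card := by
    rw [Finset.sum_const, Finset.card_compl, nsmul_eq_mul, Nat.cast_sub S.card_le_univ,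
      ← mul_div_assoc, div_le_iff₀ hK']
    exact hr
  linarith

/-- A bound by the chord of `c ↦ c s / (r + 1 - c)`. -/
theorem adjSpectralRadius_le_of_chord {G : SimpleGraph V} {S : Finset V} {f : V → κ}
    (hf : ∀ u v, u ∉ S → v ∉ S → G.Adj u v → f u = f v) (hS : 0 < S.card) {r α β : ℝ} {q : ℕ}
    (hβ : 0 ≤ β) (hc : ∀ k, (pieceCard S f k : ℝ) < r + 1)
    (hchord : ∀ k, 0 < pieceCard S f k → (pieceCard S f k : ℝ) *
      (S.card / (r + 1 - pieceCard S f k)) ≤ α * pieceCard S f k - β)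
    (hq : q ≤ (Finset.univ.filter fun k => 0 < pieceCard S f k).card)
    (hr : α * ((Fintype.card V : ℝ) - S.card) - β * q + S.card - 1 ≤ r) :
    adjSpectralRadius G ≤ r := by
  refine adjSpectralRadius_le_of_barrier hf hS (fun v _ => hc _) ?_
  rw [sum_compl_eq_sum_pieceCard_mul S f fun c => (S.card : ℝ) / (r + 1 - c)]
  -- Empty labels contribute nothing, so β is saved only on the nonempty pieces, of which there are
  -- at least q.
  have h1 : ∑ k, (pieceCard S f k : ℝ) * (S.card / (r + 1 - pieceCard S f k)) ≤
      ∑ k, (α * pieceCard S f k - if 0 < pieceCard S f k then β else 0) := by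
    refine Finset.sum_le_sum fun k _ => ?_
    split_ifs with h
    · exact hchord k h
    · simp [Nat.eq_zero_of_not_pos h]
  have h2 : ((∑ k, pieceCard S f k : ℕ) : ℝ) = (Fintype.card V : ℝ) - S.card := by
    rw [sum_pieceCard, Nat.cast_sub S.card_le_univ]
  rw [Finset.sum_sub_distrib, ← Finset.mul_sum, ← Finset.sum_filter, Finset.sum_const,
    nsmul_eq_mul, ← Nat.cast_sum, h2] at h1
  have h3 := mul_le_mul_of_nonneg_right (Nat.cast_le (α := ℝ).2 hq) hβ
  linarith

end Barrier

/-! ### The extremal graph -/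

section Extremal

open Classical

theorem join_adj_inl_inr {V W : Type*} (G : SimpleGraph V) (H : SimpleGraph W) (v : V) (w : W) :
    (join G H).Adj (Sum.inl v) (Sum.inr w) := by
  simp [join]

theorem extremalGraph_connected (m b : ℕ) : (extremalGraph m b).Connected := by
  have h : ∀ x, (extremalGraph m b).Reachable (Sum.inl 0) x := by
    rintro (x | x)
    · rw [Subsingleton.elim x 0]
    · exact (join_adj_inl_inr _ _ _ _).reachable
  exact (SimpleGraph.connected_iff _).2 ⟨fun x y => (h x).symm.trans (h y), ⟨Sum.inl 0⟩⟩

/-- The clique is the centre with K_m; a leaf, present since b > 0, supplies the edge leaving it. -/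
theorem lt_adjSpectralRadius_extremalGraph (m : ℕ) {b : ℕ} (hb : 0 < b) :
    (m : ℝ) < adjSpectralRadius (extremalGraph m b) := by
  set K : Finset (Fin 1 ⊕ ((Fin m ⊕ Fin 3) ⊕ Fin b)) :=
    insert (Sum.inl 0) (Finset.univ.image fun i : Fin m => Sum.inr (Sum.inl (Sum.inl i))) with hK
  refine lt_adjSpectralRadius_of_clique _ (K := K) (u := Sum.inl 0)
    (v := Sum.inr (Sum.inr ⟨0, hb⟩)) ?_ ?_ ?_ ?_ (join_adj_inl_inr _ _ _ _).symm
  · intro x hx y hy hxy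
    simp only [hK, Finset.coe_insert, Finset.coe_image, Finset.coe_univ, Set.image_univ,
      Set.mem_insert_iff, Set.mem_range] at hx hy
    rcases hx with rfl | ⟨i, rfl⟩ <;> rcases hy with rfl | ⟨j, rfl⟩
    · exact absurd rfl hxy
    · exact join_adj_inl_inr _ _ _ _
    · exact (join_adj_inl_inr _ _ _ _).symm
    · simpa [extremalGraph, join] using hxy
  · rw [hK, Finset.card_insert_of_notMem (by simp), Finset.card_image_of_injective, Finset.card_univ,
      Fintype.card_fin]
    intro i j h
    simpa using h
  · simp [hK]
  · simp [hK]

/-- In a graph with all degrees odd, an odd set of vertices sends out an edge. -/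
theorem exists_adj_notMem_range_of_odd_card {V W : Type*} [Fintype V] [Fintype W]
    {F : SimpleGraph V} (hF : ∀ v, Odd (F.neighborSet v).ncard) {ι : W → V} (hι : Function.Injective ι)
    (hW : Odd (Fintype.card W)) : ∃ w v, F.Adj (ι w) v ∧ v ∉ Set.range ι := by
  by_contra hno
  push Not at hno
  -- Otherwise F induces on the range a graph with all degrees odd on an odd number of vertices,
  -- against the handshake lemma.
  have hdeg : ∀ w, Odd ((F.comap ι).degree w) := by
    intro w
    have : (F.neighborSet (ι w)) = ι '' ((F.comap ι).neighborSet w) := by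
      ext v
      constructor
      · intro hv
        obtain ⟨u, rfl⟩ := hno w v hv
        exact ⟨u, hv, rfl⟩
      · rintro ⟨u, hu, rfl⟩
        exact hu
    have h := hF (ι w)
    rw [this, Set.ncard_image_of_injective _ hι, Set.ncard_eq_toFinset_card'] at h
    exact h
  have h := (F.comap ι).even_card_odd_degree_vertices
  rw [Finset.filter_true_of_mem fun w _ => hdeg w, Finset.card_univ] at h
  exact Nat.not_even_iff_odd.2 hW h

/-- K_m, K_3 and the b single vertices are odd, and their only outside neighbour is the centre,
whose factor degree would be at least b + 2. -/
theorem not_hasOddFactor_extremalGraph {m : ℕ} (hm : Odd m) (b : ℕ) :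
    ¬ HasOddFactor (extremalGraph m b) b := by
  rintro ⟨F, hF, hdeg⟩
  have hodd := fun v => (hdeg v).1
  set c : Fin 1 ⊕ ((Fin m ⊕ Fin 3) ⊕ Fin b) := Sum.inl 0 with hc
  obtain ⟨p, hp⟩ : ∃ i : Fin m, F.Adj c (Sum.inr (Sum.inl (Sum.inl i))) := by
    obtain ⟨i, v, hadj, hv⟩ := exists_adj_notMem_range_of_odd_card hodd
      (ι := fun i : Fin m => (Sum.inr (Sum.inl (Sum.inl i)) : Fin 1 ⊕ ((Fin m ⊕ Fin 3) ⊕ Fin b)))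
      (fun i j h => by simpa using h) (by simpa using hm)
    refine ⟨i, ?_⟩
    have h := hF hadj
    rcases v with v | (v | v) | v <;> simp_all [extremalGraph, join]
    rw [Subsingleton.elim v 0] at hadj
    exact hadj.symm
  obtain ⟨q, hq⟩ : ∃ i : Fin 3, F.Adj c (Sum.inr (Sum.inl (Sum.inr i))) := by
    obtain ⟨i, v, hadj, hv⟩ := exists_adj_notMem_range_of_odd_card hodd
      (ι := fun i : Fin 3 => (Sum.inr (Sum.inl (Sum.inr i)) : Fin 1 ⊕ ((Fin m ⊕ Fin 3) ⊕ Fin b)))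
      (fun i j h => by simpa using h) (by simp; decide)
    refine ⟨i, ?_⟩
    have h := hF hadj
    rcases v with v | (v | v) | v <;> simp_all [extremalGraph, join]
    rw [Subsingleton.elim v 0] at hadj
    exact hadj.symm
  have hl : ∀ i : Fin b, F.Adj c (Sum.inr (Sum.inr i)) := by
    intro i
    obtain ⟨v, hadj⟩ := Set.nonempty_of_ncard_ne_zero (hodd (Sum.inr (Sum.inr i))).pos.ne'
    have h := hF hadj
    rcases v with v | (v | v) | v <;> simp_all [extremalGraph, join]
    rw [Subsingleton.elim v 0] at hadj
    exact hadj.symm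
  set T : Finset (Fin 1 ⊕ ((Fin m ⊕ Fin 3) ⊕ Fin b)) :=
    insert (Sum.inr (Sum.inl (Sum.inl p))) (insert (Sum.inr (Sum.inl (Sum.inr q)))
      (Finset.univ.image fun i : Fin b => Sum.inr (Sum.inr i))) with hT
  have hTcard : T.card = b + 2 := by
    rw [hT, Finset.card_insert_of_notMem (by simp), Finset.card_insert_of_notMem (by simp),
      Finset.card_image_of_injective, Finset.card_univ, Fintype.card_fin]
    intro i j h
    simpa using h
  have hsub : (T : Set _) ⊆ F.neighborSet c := by
    intro x hx
    simp only [hT, Finset.coe_insert, Finset.coe_image, Finset.coe_univ, Set.image_univ,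
      Set.mem_insert_iff, Set.mem_range] at hx
    rcases hx with rfl | rfl | ⟨i, rfl⟩
    exacts [hp, hq, hl i]
  have h1 := Set.ncard_le_ncard hsub
  rw [Set.ncard_coe_finset, hTcard] at h1
  have := (hdeg c).2
  omega

theorem HasOddFactor.of_iso {V W : Type*} {G : SimpleGraph V} {H : SimpleGraph W} {b : ℕ}
    (e : G ≃g H) (h : HasOddFactor G b) : HasOddFactor H b := by
  obtain ⟨F, hF, hdeg⟩ := h
  refine ⟨F.comap e.symm, fun u v huv => e.symm.map_adj_iff.1 (hF huv), fun v => ?_⟩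
  have : (F.comap e.symm).neighborSet v = e '' F.neighborSet (e.symm v) := by
    ext u
    constructor
    · intro hu
      exact ⟨e.symm u, hu, by simp⟩
    · rintro ⟨w, hw, rfl⟩
      simpa using hw
  rw [this, Set.ncard_image_of_injective _ e.injective]
  exact hdeg _

end Extremal

/-! ### Comparison with the extremal graph and conclusion -/

section Main

open Classical

theorem exists_equiv_extremalGraph {V κ : Type*} [Fintype V] [Fintype κ] {G : SimpleGraph V}
    {S : Finset V} {f : V → κ} (hf : ∀ u v, u ∉ S → v ∉ S → G.Adj u v → f u = f v)
    (hS : S.card = 1) {k l : κ} {m b : ℕ} (hlk : l ≠ k) (hk : pieceCard S f k = m)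
    (hl : pieceCard S f l = 3)
    (hb : b ≤ (Finset.univ.filter fun j => j ≠ k ∧ j ≠ l ∧ 0 < pieceCard S f j).card)
    (hV : Fintype.card V = m + b + 4) :
    ∃ e : V ≃ Fin 1 ⊕ ((Fin m ⊕ Fin 3) ⊕ Fin b),
      ∀ u v, G.Adj u v → (extremalGraph m b).Adj (e u) (e v) := by
  set P := Finset.univ.filter fun v => v ∉ S ∧ f v = k with hP
  set Q := Finset.univ.filter fun v => v ∉ S ∧ f v = l with hQ
  set R := Finset.univ.filter fun v => v ∉ S ∧ f v ≠ k ∧ f v ≠ l with hR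
  have hRb : R.card = b := by
    have h1 : (Finset.univ : Finset V) = S ∪ (P ∪ (Q ∪ R)) := by
      ext v
      simp only [hP, hQ, hR, Finset.mem_univ, Finset.mem_union, Finset.mem_filter, true_and]
      tauto
    have h2 : Disjoint Q R := Finset.disjoint_left.2 fun v hv hv' =>
      (Finset.mem_filter.1 hv').2.2.2 (Finset.mem_filter.1 hv).2.2
    have h3 : Disjoint P (Q ∪ R) := Finset.disjoint_left.2 fun v hv hv' => by
      have hvk := (Finset.mem_filter.1 hv).2.2
      rcases Finset.mem_union.1 hv' with h | h
      · exact hlk ((Finset.mem_filter.1 h).2.2.symm.trans hvk)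
      · exact (Finset.mem_filter.1 h).2.2.1 hvk
    have h4 : Disjoint S (P ∪ (Q ∪ R)) := Finset.disjoint_left.2 fun v hv hv' => by
      simp only [hP, hQ, hR, Finset.mem_union, Finset.mem_filter] at hv'
      tauto
    have h5 := Finset.card_univ (α := V)
    rw [h1, Finset.card_union_of_disjoint h4, Finset.card_union_of_disjoint h3,
      Finset.card_union_of_disjoint h2] at h5
    have h6 : P.card = m := hk
    have h7 : Q.card = 3 := hl
    omega
  -- The b vertices of R carry at least b labels, so each is a piece by itself and no edge joins two
  -- of them.
  have hinj : Set.InjOn f R := by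
    rw [← Finset.card_image_iff]
    refine le_antisymm Finset.card_image_le ?_
    rw [hRb]
    refine hb.trans (Finset.card_le_card fun j hj => ?_)
    obtain ⟨-, hjk, hjl, hj0⟩ := Finset.mem_filter.1 hj
    obtain ⟨v, hv⟩ := Finset.card_pos.1 hj0
    obtain ⟨-, hvS, rfl⟩ := Finset.mem_filter.1 hv
    exact Finset.mem_image.2 ⟨v, Finset.mem_filter.2 ⟨Finset.mem_univ _, hvS, hjk, hjl⟩, rfl⟩
  have hmR : ∀ v, v ∉ S → v ∉ P → v ∉ Q → v ∈ R := by
    intro v h1 h2 h3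
    simp only [hP, hQ, Finset.mem_filter, Finset.mem_univ, true_and, not_and] at h2 h3
    exact Finset.mem_filter.2 ⟨Finset.mem_univ _, h1, h2 h1, h3 h1⟩
  let eS : S ≃ Fin 1 := Finset.equivFinOfCardEq hS
  let eP : P ≃ Fin m := Finset.equivFinOfCardEq hk
  let eQ : Q ≃ Fin 3 := Finset.equivFinOfCardEq hl
  let eR : R ≃ Fin b := Finset.equivFinOfCardEq hRb
  let e : V → Fin 1 ⊕ ((Fin m ⊕ Fin 3) ⊕ Fin b) := fun v =>
    if h1 : v ∈ S then Sum.inl (eS ⟨v, h1⟩)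
    else if h2 : v ∈ P then Sum.inr (Sum.inl (Sum.inl (eP ⟨v, h2⟩)))
    else if h3 : v ∈ Q then Sum.inr (Sum.inl (Sum.inr (eQ ⟨v, h3⟩)))
    else Sum.inr (Sum.inr (eR ⟨v, hmR v h1 h2 h3⟩))
  have he : Function.Injective e := by
    intro u v huv
    simp only [e] at huv
    split_ifs at huv <;> simp_all
  have hbij : Function.Bijective e := by
    rw [Fintype.bijective_iff_injective_and_card]
    refine ⟨he, ?_⟩
    simp only [Fintype.card_sum, Fintype.card_fin]
    omega
  refine ⟨Equiv.ofBijective e hbij, fun u v huv => ?_⟩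
  have hne := G.ne_of_adj huv
  have hfuv : u ∉ S → v ∉ S → f u = f v := fun hu hv => hf u v hu hv huv
  have hmP : ∀ w, w ∉ S → (w ∈ P ↔ f w = k) := fun w hw => by simp [hP, hw]
  have hmQ : ∀ w, w ∉ S → (w ∈ Q ↔ f w = l) := fun w hw => by simp [hQ, hw]
  change (extremalGraph m b).Adj (e u) (e v)
  by_cases hu : u ∈ S
  · by_cases hv : v ∈ S
    · exact absurd (Finset.card_le_one.1 hS.le u hu v hv) hne
    · have h : ∃ x, e v = Sum.inr x := by
        simp only [e, dif_neg hv]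
        split_ifs
        exacts [⟨_, rfl⟩, ⟨_, rfl⟩, ⟨_, rfl⟩]
      obtain ⟨x, hx⟩ := h
      rw [hx]
      simp only [e, dif_pos hu]
      exact join_adj_inl_inr _ _ _ _
  · by_cases hv : v ∈ S
    · have h : ∃ x, e u = Sum.inr x := by
        simp only [e, dif_neg hu]
        split_ifs
        exacts [⟨_, rfl⟩, ⟨_, rfl⟩, ⟨_, rfl⟩]
      obtain ⟨x, hx⟩ := h
      rw [hx]
      simp only [e, dif_pos hv]
      exact (join_adj_inl_inr _ _ _ _).symm
    · have hfe := hfuv hu hv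
      by_cases hPu : u ∈ P
      · have hPv : v ∈ P := (hmP v hv).2 (hfe ▸ (hmP u hu).1 hPu)
        simp only [e, dif_neg hu, dif_neg hv, dif_pos hPu, dif_pos hPv]
        simpa [extremalGraph, join] using hne
      · have hPv : v ∉ P := fun h => hPu ((hmP u hu).2 (hfe.trans ((hmP v hv).1 h)))
        by_cases hQu : u ∈ Q
        · have hQv : v ∈ Q := (hmQ v hv).2 (hfe ▸ (hmQ u hu).1 hQu)
          simp only [e, dif_neg hu, dif_neg hv, dif_neg hPu, dif_neg hPv, dif_pos hQu,
            dif_pos hQv]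
          simpa [extremalGraph, join] using hne
        · have hQv : v ∉ Q := fun h => hQu ((hmQ u hu).2 (hfe.trans ((hmQ v hv).1 h)))
          exact absurd (hinj (hmR u hu hPu hQu) (hmR v hv hPv hQv) hfe) hne

theorem nonempty_iso_extremalGraph_of_equiv {V : Type*} [Fintype V] {G : SimpleGraph V} {m b : ℕ}
    (e : V ≃ Fin 1 ⊕ ((Fin m ⊕ Fin 3) ⊕ Fin b))
    (he : ∀ u v, G.Adj u v → (extremalGraph m b).Adj (e u) (e v))
    (hrho : adjSpectralRadius (extremalGraph m b) ≤ adjSpectralRadius G) :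
    Nonempty (G ≃g extremalGraph m b) := by
  have : Nonempty V := ⟨e.symm (Sum.inl 0)⟩
  have hH : (extremalGraph m b).comap e ≃g extremalGraph m b := SimpleGraph.Iso.comap e _
  have hle : G ≤ (extremalGraph m b).comap e := fun u v h => he u v h
  have heq := eq_of_le_of_adjSpectralRadius_le
    (hH.connected_iff.2 (extremalGraph_connected m b)) hle
    ((adjSpectralRadius_congr hH).trans_le hrho)
  exact ⟨heq ▸ hH⟩

/-- The inequality behind the crude bound for barriers with at least two vertices. -/
theorem barrier_inequality {b s n : ℝ} (hs : s = 2 ∨ s = 3 ∨ 4 ≤ s)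
    (hb : 3 ≤ b ∨ b = 1 ∧ 14 ≤ n) (hn : s + b * s + 6 ≤ n) :
    (n - s) * s ≤ (n - b - 4 + 1 - s) * (s + b * s - b) := by
  rcases hb with hb | ⟨rfl, hn14⟩
  -- Shifting b, s and n to their lower bounds turns the difference into a polynomial with
  -- nonnegative coefficients.
  · obtain ⟨p, hp, rfl⟩ : ∃ p : ℝ, 0 ≤ p ∧ b = 3 + p := ⟨b - 3, by linarith, by ring⟩
    obtain ⟨u, hu, rfl⟩ : ∃ u : ℝ, 0 ≤ u ∧ s = 2 + u :=
      ⟨s - 2, by rcases hs with h | h | h <;> linarith, by ring⟩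
    obtain ⟨d, hd, rfl⟩ : ∃ d : ℝ, 0 ≤ d ∧ n = 2 + u + (3 + p) * (2 + u) + 6 + d :=
      ⟨n - (2 + u + (3 + p) * (2 + u) + 6), by linarith, by ring⟩
    rw [← sub_nonneg]
    ring_nf
    positivity
  · rcases hs with rfl | rfl | hs
    · linarith
    · linarith
    · nlinarith

/-- The maximal piece size n - s - bs - 3 suffices for the crude bound except when b = 1 and n = 12.
There it fails for s = 2 and s = 3, and the number of pieces must be used too. -/
theorem adjSpectralRadius_le_of_two_le_card {V κ : Type*} [Fintype V] [Fintype κ]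
    {G : SimpleGraph V} {S : Finset V} {f : V → κ} {b m : ℕ} (hb : Odd b)
    (hf : ∀ u v, u ∉ S → v ∉ S → G.Adj u v → f u = f v)
    (hS : 2 ≤ S.card) (hV : Fintype.card V = m + b + 4) (hV12 : 12 ≤ Fintype.card V)
    (heven : Even (Fintype.card V))
    (hodd : b * S.card + 2 ≤ (Finset.univ.filter fun k => Odd (pieceCard S f k)).card)
    (hbig : ∀ k, pieceCard S f k + b * S.card + 3 ≤ Fintype.card V - S.card)
    (htot : b * S.card + 6 ≤ Fintype.card V - S.card) :
    adjSpectralRadius G ≤ m := by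
  have hb1 : 1 ≤ b := hb.pos
  have hmR : (m : ℝ) = (Fintype.card V : ℝ) - b - 4 := by
    rw [hV]; push_cast; ring
  have htot' : (S.card : ℝ) + b * S.card + 6 ≤ Fintype.card V := by
    have : S.card + b * S.card + 6 ≤ Fintype.card V := by omega
    exact_mod_cast this
  by_cases hspecial : b = 1 ∧ Fintype.card V = 12
  · obtain ⟨rfl, h12⟩ := hspecial
    have hm7 : m = 7 := by omega
    subst hm7
    have hq : S.card + 2 ≤ (Finset.univ.filter fun k => 0 < pieceCard S f k).card := by
      rw [one_mul] at hodd
      refine hodd.trans (Finset.card_le_card fun k hk => ?_)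
      exact Finset.mem_filter.2 ⟨Finset.mem_univ _, (Finset.mem_filter.1 hk).2.pos⟩
    have hs : S.card = 2 ∨ S.card = 3 := by omega
    have hc5 : ∀ k, pieceCard S f k ≤ 5 := fun k => by have := hbig k; omega
    have hlt : ∀ k, (pieceCard S f k : ℝ) < ((7 : ℕ) : ℝ) + 1 := fun k => by
      have : (pieceCard S f k : ℝ) ≤ 5 := by exact_mod_cast hc5 k
      push_cast; linarith
    rcases hs with hs | hs
    -- Pieces have size at most 5; α and β come from the chord of 2c / (8 - c) through c = 1 and c =
    -- 5.
    · refine adjSpectralRadius_le_of_chord hf (by omega) (α := 16 / 21) (β := 10 / 21)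
        (by norm_num) hlt (fun k hk => ?_) hq ?_
      · have h5 := hc5 k
        rw [hs]
        generalize pieceCard S f k = c at hk h5
        interval_cases c <;> norm_num
      · rw [hs, h12]; norm_num
    -- Pieces have size at most 3; the chord of 3c / (8 - c) passes through c = 1 and c = 3.
    · refine adjSpectralRadius_le_of_chord hf (by omega) (α := 24 / 35) (β := 9 / 35)
        (by norm_num) hlt (fun k hk => ?_) hq ?_
      · have h3 : pieceCard S f k ≤ 3 := by have := hbig k; omega
        rw [hs]
        generalize pieceCard S f k = c at hk h3
        interval_cases c <;> norm_num
      · rw [hs, h12]; norm_num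
  · have hs2 : (2 : ℝ) ≤ S.card := by exact_mod_cast hS
    have hbR : (1 : ℝ) ≤ b := by exact_mod_cast hb1
    refine adjSpectralRadius_le_of_pieceCard_le hf (by omega)
      (K := (Fintype.card V : ℝ) - S.card - b * S.card - 3) (fun k => ?_) ?_ ?_
    · have : pieceCard S f k + b * S.card + 3 + S.card ≤ Fintype.card V := by
        have := hbig k
        omega
      have : (pieceCard S f k : ℝ) + b * S.card + 3 + S.card ≤ Fintype.card V := by
        exact_mod_cast this
      linarith
    · rw [hmR]
      nlinarith
    · have := barrier_inequality (b := b) (s := S.card) (n := Fintype.card V) ?_ ?_ htot'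
      · rw [hmR]
        refine this.trans (le_of_eq ?_)
        ring
      · have : S.card = 2 ∨ S.card = 3 ∨ 4 ≤ S.card := by omega
        exact_mod_cast this
      · have : 3 ≤ b ∨ b = 1 ∧ 14 ≤ Fintype.card V := by
          obtain ⟨i, hi⟩ := hb
          obtain ⟨j, hj⟩ := heven
          omega
        exact_mod_cast this

theorem nonempty_iso_extremalGraph_of_not_hasOddFactor {V : Type*} [Fintype V]
    {G : SimpleGraph V} {b m : ℕ} (hb : Odd b) (hV : Fintype.card V = m + b + 4)
    (heven : Even (Fintype.card V)) (hV12 : 12 ≤ Fintype.card V)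
    (hVb : 2 * b + 8 ≤ Fintype.card V) (hconn : G.Connected)
    (hbind : IsBinding G (1 / (b : ℝ)))
    (hrho : adjSpectralRadius (extremalGraph m b) ≤ adjSpectralRadius G)
    (hG : ¬ HasOddFactor G b) : Nonempty (G ≃g extremalGraph m b) := by
  obtain ⟨S, κ, _, f, hf, hlt⟩ := exists_barrier_of_not_hasOddFactor hb hG
  have hm : (m : ℝ) < adjSpectralRadius G :=
    (lt_adjSpectralRadius_extremalGraph m hb.pos).trans_le hrho
  obtain ⟨hS0, hodd⟩ := barrier_nonempty_and_add_two_le hb heven hconn hf hlt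
  have hSu : S ≠ Finset.univ := by
    rintro rfl
    obtain ⟨k, hk⟩ := Finset.card_pos.1 (lt_of_lt_of_le (by omega) hodd)
    have := (Finset.mem_filter.1 hk).2
    simp [pieceCard] at this
  have hone := card_singleton_pieces_le hb.pos hbind hf hSu
  have hex := exists_second_piece hodd hone
  rw [sum_pieceCard] at hex
  have hbig : ∀ k, pieceCard S f k + b * S.card + 3 ≤ Fintype.card V - S.card := fun k => by
    obtain ⟨l, -, hl, -, h⟩ := hex k
    omega
  have htot : b * S.card + 6 ≤ Fintype.card V - S.card := by
    obtain ⟨v, -⟩ := Finset.card_pos.1 hS0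
    obtain ⟨l, -, hl, -⟩ := hex (f v)
    have := hbig l
    omega
  by_cases hS2 : 2 ≤ S.card
  · exact absurd hm (not_lt.2 (adjSpectralRadius_le_of_two_le_card hb hf hS2 hV hV12 heven hodd
      hbig htot))
  · have hS1 : S.card = 1 := by omega
    rw [hS1, mul_one] at hbig
    by_cases hk : ∃ k, m ≤ pieceCard S f k
    · obtain ⟨k, hk⟩ := hk
      obtain ⟨l, hlk, hl3, hcard, hsum⟩ := hex k
      rw [hS1, mul_one] at hcard hsum
      have := hbig k
      -- Both sizes are forced: `hbig` gives at most m for k, and the total m + b + 3 then leaves at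
      -- most 3 for l.
      obtain ⟨e, he⟩ := exists_equiv_extremalGraph hf hS1 hlk (m := m) (by omega) (by omega)
        hcard hV
      exact nonempty_iso_extremalGraph_of_equiv e he hrho
    · push Not at hk
      refine absurd hm (not_lt.2 (adjSpectralRadius_le_of_pieceCard_le hf hS0 (K := (m : ℝ) - 1)
        (fun k => ?_) (by linarith) ?_))
      · have : (pieceCard S f k : ℝ) + 1 ≤ m := by exact_mod_cast hk k
        linarith
      -- With s = 1 and K = m - 1 the requirement is m + b + 3 ≤ 2m, which follows from n ≥ 2b + 8,
      -- that is, m ≥ b + 4.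
      · have h1 : (2 * b + 8 : ℝ) ≤ m + b + 4 := by
          have := hV ▸ hVb
          exact_mod_cast this
        have hb1 : (1 : ℝ) ≤ b := by exact_mod_cast hb.pos
        rw [hS1, hV]
        push_cast
        linarith

end Main
end BindingGraph

theorem theorem1p2 {V : Type*} [Fintype V] (G : SimpleGraph V) (b n : ℕ)
    (hb1 : 1 ≤ b) (hb : Odd b)
    (hcard : Fintype.card V = n) (heven : Even n) (hn : max 12 (2 * b + 8) ≤ n)
    (hconn : G.Connected) (hbind : BindingGraph.IsBinding G (1 / (b : ℝ)))
    (hrho : BindingGraph.adjSpectralRadius (BindingGraph.extremalGraph (n - b - 4) b) ≤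
      BindingGraph.adjSpectralRadius G) :
    BindingGraph.HasOddFactor G b ↔
      ¬ Nonempty (G ≃g BindingGraph.extremalGraph (n - b - 4) b) := by
  subst hcard
  obtain ⟨h12, hnb⟩ := max_le_iff.1 hn
  constructor
  · rintro h ⟨e⟩
    refine BindingGraph.not_hasOddFactor_extremalGraph ?_ b (h.of_iso e)
    obtain ⟨i, hi⟩ := hb
    obtain ⟨j, hj⟩ := heven
    exact ⟨j - i - 3, by omega⟩
  · intro h
    by_contra hG
    exact h (BindingGraph.nonempty_iso_extremalGraph_of_not_hasOddFactor hb (by omega) heven h12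
      hnb hconn hbind hrho hG)
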